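/- Let $X$ and $Y$ be smooth, irreducible, projective curves over $\mathbb{C}$ and let $p : X \to Y$ be a covering (a finite, flat, surjective morphism over $\mathbb{C}$) of degree $d \neq 2$. Let $D \subset Y$ be the branch locus of $p$, let $Y_0 = Y(\mathbb{C}) \setminus D$ with the classical topology, and let $y_0 \in Y_0$. Suppose that the monodromy group of $p$ is the full symmetric group $S_d$, i.e. the image of the monodromy action of $\pi_1(Y_0, y_0)$ on the $d$ points of the fibre $p^{-1}(y_0)$ is the group of all permutations of that fibre. Then $\mathrm{Aut}(X/Y) = \{1\}$: the only automorphism $f$ of $X$ with $p \circ f = p$ is the identity. -/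

import Mathlib

open CategoryTheory AlgebraicGeometry

noncomputable section

namespace CurveCover

/-- The base scheme `Spec ℂ`. -/
abbrev SpecC : Scheme.{0} := Spec (CommRingCat.of ℂ)

/-- The grading of `ℂ[x₀, …, xₙ]` by degree. -/
abbrev grading (n : ℕ) : ℕ → Submodule ℂ (MvPolynomial (Fin (n + 1)) ℂ) :=
  MvPolynomial.homogeneousSubmodule (Fin (n + 1)) ℂ

instance gradedRing (n : ℕ) : GradedRing (grading n) :=
  MvPolynomial.gradedAlgebra

/-- Projective space `ℙⁿ = Proj ℂ[x₀, …, xₙ]` as a scheme over `ℂ`. -/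
def projectiveSpace (n : ℕ) : Over SpecC :=
  Over.mk (Proj.toSpecZero (grading n) ≫
    Spec.map (CommRingCat.ofHom (algebraMap ℂ (grading n 0))))

/-- A smooth, irreducible, projective curve over `ℂ`. -/
structure IsSmoothProjectiveCurve (X : Over SpecC) : Prop where
  smooth : SmoothOfRelativeDimension 1 X.hom
  irreducible : IrreducibleSpace X.left
  projective : ∃ (n : ℕ) (i : X ⟶ projectiveSpace n), IsClosedImmersion i.left

/-- `p : X ⟶ Y` is a covering of degree `d`: it is finite, flat and surjective, and the locally
free sheaf `p_* 𝒪_X` has rank `d` at every point of `Y`. -/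
structure IsCoveringOfDegree {X Y : Scheme.{0}} (p : X ⟶ Y) (d : ℕ) : Prop where
  finite : IsFinite p
  flat : Flat p
  surjective : Surjective p
  degree : ∀ y : Y, p.finrank y = d

/-- The complement in `Y` of the branch locus of a covering `p : X ⟶ Y`: the largest open subscheme
of `Y` over which `p` is étale. -/
def unbranchedLocus {X Y : Scheme.{0}} (p : X ⟶ Y) : Y.Opens :=
  sSup {U : Y.Opens | Etale (p ∣_ U)}

/-- The set `X(ℂ)` of complex points of a `ℂ`-scheme `X`. -/
def ComplexPoints (X : Over SpecC) : Type :=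
  {x : SpecC ⟶ X.left // x ≫ X.hom = 𝟙 SpecC}

namespace ComplexPoints

variable {X Y : Over SpecC}

/-- The complex point `x` lies in the open subscheme `U`. -/
def LiesIn (x : ComplexPoints X) (U : X.left.Opens) : Prop :=
  ⊤ ≤ x.1 ⁻¹ᵁ U

/-- The value `f(x) ∈ ℂ` of a regular function `f` on `U` at a complex point `x` of `U`. -/
def eval (x : ComplexPoints X) {U : X.left.Opens} (hx : x.LiesIn U) (f : Γ(X.left, U)) : ℂ :=
  (Scheme.ΓSpecIso (CommRingCat.of ℂ)).hom (x.1.appLE U ⊤ hx f)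

/-- The classical (complex analytic) topology on `X(ℂ)`: it is generated by the sets
`{x ∈ U(ℂ) | f(x) ∈ V}`, for `U` Zariski open in `X`, `f` a regular function on `U`, and `V` open
in `ℂ`. -/
instance classicalTopology (X : Over SpecC) : TopologicalSpace (ComplexPoints X) :=
  TopologicalSpace.generateFrom
    {S | ∃ (U : X.left.Opens) (f : Γ(X.left, U)) (V : Set ℂ), IsOpen V ∧
      S = {x : ComplexPoints X | ∃ hx : x.LiesIn U, x.eval hx f ∈ V}}

/-- The map `X(ℂ) → Y(ℂ)` induced by a morphism `p : X ⟶ Y` of `ℂ`-schemes. -/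
def map (p : X ⟶ Y) (x : ComplexPoints X) : ComplexPoints Y :=
  ⟨x.1 ≫ p.left, by rw [Category.assoc, Over.w p, x.2]⟩

end ComplexPoints

/-- The monodromy group at `b` of a covering map `p : E → B`: the group of all permutations of the
fibre `p⁻¹(b)` that are induced by some loop `γ` at `b`, by sending a point `e` of the fibre to the
endpoint of the lift of `γ` that starts at `e`. -/
def monodromyGroup {E B : Type*} [TopologicalSpace E] [TopologicalSpace B] (p : E → B) (b : B) :
    Subgroup (Equiv.Perm (p ⁻¹' {b})) where
  carrier := {σ | ∃ γ : Path b b, ∀ e : p ⁻¹' {b},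
    ∃ γ' : Path (e : E) (σ e : E), ∀ t, p (γ' t) = γ t}
  one_mem' := ⟨Path.refl b, fun e => ⟨Path.refl (e : E), fun _ => e.2⟩⟩
  mul_mem' := by
    rintro σ τ ⟨γ, hγ⟩ ⟨δ, hδ⟩
    refine ⟨δ.trans γ, fun e => ?_⟩
    obtain ⟨δ', h1⟩ := hδ e
    obtain ⟨γ', h2⟩ : ∃ γ' : Path (τ e : E) ((σ * τ) e : E), ∀ t, p (γ' t) = γ t := hγ (τ e)
    refine ⟨δ'.trans γ', fun t => ?_⟩
    rw [Path.trans_apply, Path.trans_apply]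
    split_ifs
    · exact h1 _
    · exact h2 _
  inv_mem' := by
    rintro σ ⟨γ, hγ⟩
    refine ⟨γ.symm, fun e => ?_⟩
    obtain ⟨γ', h⟩ := hγ (σ⁻¹ e)
    exact ⟨(γ'.cast rfl (by simp)).symm, fun t => h _⟩

/-- For a covering map, the monodromy group is the image of the monodromy homomorphism from the
fundamental group of the base to the group of permutations of the fibre. -/
theorem range_monodromyPerm {E B : Type*} [TopologicalSpace E] [TopologicalSpace B] {p : E → B}
    (cov : IsCoveringMap p) (b : B) : (cov.monodromyPerm b).range = monodromyGroup p b := by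
  ext σ
  constructor
  · rintro ⟨γ, rfl⟩
    obtain ⟨γ, rfl⟩ := Path.Homotopic.Quotient.mk_surjective γ
    refine ⟨γ, fun e => ?_⟩
    have h0 : γ 0 = p e := γ.source.trans e.2.symm
    exact ⟨⟨cov.liftPath γ e h0, cov.liftPath_zero .., rfl⟩,
      fun t => congrFun (cov.liftPath_lifts γ e h0) t⟩
  · rintro ⟨γ, hγ⟩
    refine ⟨Path.Homotopic.Quotient.mk γ, Equiv.ext fun e => ?_⟩
    obtain ⟨γ', h⟩ := hγ e
    rw [cov.coe_monodromyPerm]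
    refine cov.monodromy_eq_of_map_eq (Path.Homotopic.Quotient.mk γ') ?_
    exact congrArg Path.Homotopic.Quotient.mk (Path.ext (funext h))

/-- The set `Y₀ ⊆ Y(ℂ)` of complex points outside the branch locus of `p : X ⟶ Y`. -/
def unbranchedPoints {X Y : Over SpecC} (p : X ⟶ Y) : Set (ComplexPoints Y) :=
  {y | y.LiesIn (unbranchedLocus p.left)}

/-- The topological covering `X₀ → Y₀` that `p : X ⟶ Y` induces over the complement `Y₀ ⊆ Y(ℂ)` of
its branch locus, where `X₀ ⊆ X(ℂ)` is the preimage of `Y₀`. -/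
def unbranchedCover {X Y : Over SpecC} (p : X ⟶ Y) :
    (ComplexPoints.map p ⁻¹' unbranchedPoints p : Set (ComplexPoints X)) → unbranchedPoints p :=
  (unbranchedPoints p).restrictPreimage (ComplexPoints.map p)

end CurveCover

end

/-! ### Permutations and commutative algebra -/

open scoped TensorProduct

/-! An automorphism over `Y` carries lifts of a loop to lifts of the same loop. As lifts are unique
(`eq_of_map_eq`), it commutes on the fibre over `y₀` with the monodromy, hence with every
permutation. The fibre has `d ≠ 2` points (`card_fibre`), so commuting with all permutations forces
it to fix each of them. An endomorphism over `Y` fixing one unbranched point is the identity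
(`eq_id_of_map_eq_self`), because `X` is integral.

Both uniqueness statements rest on `exists_separating`: an unramified algebra carries a tensor whose
value on a pair of homomorphisms to a domain that agree on the base is 1 if they are equal and 0
otherwise. Existence of lifts is part of `monodromyGroup`, so `X₀ → Y₀` need not be shown to be a
topological covering. -/

theorem Equiv.Perm.eq_self_of_forall_comm {α : Type*} (h2 : Nat.card α ≠ 2) (φ : α → α)
    (h : ∀ (σ : Equiv.Perm α) (a : α), φ (σ a) = σ (φ a)) (a : α) : φ a = a := by
  classical
  by_contra hne
  obtain ⟨z, hza, hzb⟩ : ∃ z, z ≠ a ∧ z ≠ φ a := by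
    by_contra! hz
    refine h2 (Nat.card_eq_two_iff.mpr ⟨a, φ a, Ne.symm hne, ?_⟩)
    ext z
    simp only [Set.mem_insert_iff, Set.mem_singleton_iff, Set.mem_univ, iff_true]
    exact or_iff_not_imp_left.mpr (hz z)
  -- This transposition fixes `a` but moves `φ a`.
  have := h (Equiv.swap (φ a) z) a
  rw [Equiv.swap_apply_of_ne_of_ne (Ne.symm hne) hza.symm, Equiv.swap_apply_left] at this
  exact hzb this.symm

/-- A smooth algebra over a field is reduced. -/
theorem Algebra.Smooth.isReduced_of_field (K : Type*) {S : Type*} [Field K] [CommRing S]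
    [Algebra K S] [Algebra.Smooth K S] : IsReduced S := by
  refine ⟨fun s hs => ?_⟩
  -- Integral closure commutes with smooth base change. So for nilpotent `s` the integral element `s
  -- ⊗ X` comes from `S ⊗ K`, where the coefficient of `X` vanishes; but that coefficient is `s`.
  have hint : IsIntegral S (s ⊗ₜ[K] (Polynomial.X : Polynomial K)) := by
    obtain ⟨n, hn⟩ := hs
    refine IsIntegral.of_pow (n := n + 1) n.succ_pos ?_
    rw [Algebra.TensorProduct.tmul_pow, pow_succ, hn, zero_mul, TensorProduct.zero_tmul]
    exact isIntegral_zero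
  obtain ⟨y, hy⟩ := (TensorProduct.toIntegralClosure_bijective_of_smooth
    (R := K) (S := S) (B := Polynomial K)).2 ⟨_, hint⟩
  have hy := congrArg Subtype.val hy
  let c : S ⊗[K] Polynomial K →ₗ[K] S :=
    (_root_.TensorProduct.rid K S).toLinearMap ∘ₗ (Polynomial.lcoeff K 1).lTensor S
  have hc : ∀ y : S ⊗[K] integralClosure K (Polynomial K),
      c (TensorProduct.toIntegralClosure K S (Polynomial K) y) = 0 := by
    intro y
    induction y with
    | zero => simp
    | add x y hx hy => simp [hx, hy]
    | tmul a b =>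
      obtain ⟨b, hb⟩ := b
      have hb0 : b.natDegree = 0 := by
        by_contra h0
        exact (b.transcendental h0 (mem_nonZeroDivisors_of_ne_zero
          (by simpa using fun h : b = 0 => h0 (by simp [h])))) (_root_.IsIntegral.isAlgebraic hb)
      have : b.coeff 1 = 0 := Polynomial.coeff_eq_zero_of_natDegree_lt (by omega)
      simp [c, TensorProduct.toIntegralClosure, this]
  have := (hc y).symm.trans (congrArg c hy)
  simpa [c] using this.symm

/-- A smooth scheme over a field is reduced. -/
theorem AlgebraicGeometry.Smooth.isReduced_of_field {K : Type} [Field K] {X : Scheme.{0}}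
    (f : X ⟶ Spec (CommRingCat.of K)) [Smooth f] : IsReduced X := by
  refine @isReduced_of_isReduced_stalk X fun x => ?_
  obtain ⟨_, ⟨V, hV, rfl⟩, hxV, -⟩ :=
    X.isBasis_affineOpens.exists_subset_of_mem_open (Set.mem_univ x) isOpen_univ
  have hs : ((Scheme.ΓSpecIso (CommRingCat.of K)).inv ≫ f.appLE ⊤ V le_top).hom.Smooth := by
    refine (RingHom.Smooth.respectsIso.cancel_left_isIso _ _).mpr ?_
    exact f.smooth_appLE (isAffineOpen_top _) hV le_top
  have hred : _root_.IsReduced Γ(X, V) := by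
    algebraize [((Scheme.ΓSpecIso (CommRingCat.of K)).inv ≫ f.appLE ⊤ V le_top).hom]
    exact Algebra.Smooth.isReduced_of_field K
  let _ := TopCat.Presheaf.algebra_section_stalk X.presheaf (⟨x, hxV⟩ : V)
  have _ := hV.isLocalization_stalk ⟨x, hxV⟩
  exact isReduced_localizationPreserves (hV.primeIdealOf ⟨x, hxV⟩).asIdeal.primeCompl _ hred

/-- An unramified algebra has a tensor which separates homomorphisms that agree on the base. -/
theorem Algebra.FormallyUnramified.exists_separating {A B : Type*} [CommRing A] [CommRing B]
    [Algebra A B] [Algebra.EssFiniteType A B] [Algebra.FormallyUnramified A B] :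
    ∃ s : Finset (B × B), ∀ {K : Type*} [CommRing K] (φ ψ : B →+* K),
      φ.comp (algebraMap A B) = ψ.comp (algebraMap A B) →
        (∀ b, (φ b - ψ b) * ∑ i ∈ s, φ i.1 * ψ i.2 = 0) ∧
        (φ = ψ → ∑ i ∈ s, φ i.1 * ψ i.2 = 1) := by
  -- `t` is killed by every `1 ⊗ b - b ⊗ 1` and multiplies out to 1; the sum is its image under `φ ⊗
  -- ψ`.
  obtain ⟨t, ht, ht1⟩ := (Algebra.FormallyUnramified.iff_exists_tensorProduct
    (R := A) (S := B)).mp inferInstance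
  obtain ⟨s, rfl⟩ := TensorProduct.exists_finset t
  refine ⟨s, fun {K} _ φ ψ h => ?_⟩
  let _ := (φ.comp (algebraMap A B)).toAlgebra
  let φ' : B →ₐ[A] K := { φ with commutes' := fun r => rfl }
  let ψ' : B →ₐ[A] K := { ψ with commutes' := fun r => (congr($h r)).symm }
  have hs : Algebra.TensorProduct.productMap φ' ψ' (∑ i ∈ s, i.1 ⊗ₜ[A] i.2) =
      ∑ i ∈ s, φ i.1 * ψ i.2 := by
    simp [φ', ψ']
  refine ⟨fun b => ?_, ?_⟩
  · have := congrArg (Algebra.TensorProduct.productMap φ' ψ') (ht b)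
    rw [map_mul, hs, map_zero] at this
    have hb : Algebra.TensorProduct.productMap φ' ψ' (1 ⊗ₜ[A] b - b ⊗ₜ[A] 1) = ψ b - φ b := by
      simp [φ', ψ']
    rw [hb] at this
    linear_combination -this
  · rintro rfl
    have := congrArg φ ht1
    simpa using this

/-- The homomorphisms from a finite étale algebra over an algebraically closed field to that field
are as many as its dimension. -/
theorem Algebra.Etale.card_algHom_eq_finrank (K C : Type*) [Field K] [IsAlgClosed K] [CommRing C]
    [Algebra K C] [Algebra.Etale K C] : Nat.card (C →ₐ[K] K) = Module.finrank K C := by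
  classical
  have := Algebra.FormallyUnramified.finite_of_free K C
  have : IsArtinianRing C := isArtinian_of_tower K inferInstance
  let e := Algebra.FormallyEtale.equivPiOfIsSepClosed K C
  have := Fintype.ofFinite (PrimeSpectrum C)
  rw [e.toLinearEquiv.finrank_eq, Module.finrank_pi, ← Nat.card_eq_fintype_card]
  refine (Nat.card_congr (Equiv.ofBijective
    (fun i : PrimeSpectrum C => (Pi.evalAlgHom K (fun _ => K) i).comp e.toAlgHom) ⟨?_, ?_⟩)).symm
  · intro i j hij
    by_contra hne
    have := congr($hij (e.symm (Pi.single i 1)))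
    simp [Ne.symm hne] at this
  · intro φ
    let φ' := φ.comp e.symm.toAlgHom
    obtain ⟨i, hi⟩ : ∃ i, φ' (Pi.single i 1) ≠ 0 := by
      by_contra! h
      have h1 := map_one φ'
      rw [← Finset.univ_sum_single (1 : PrimeSpectrum C → K), map_sum] at h1
      simp [h] at h1
    refine ⟨i, AlgHom.ext fun c => ?_⟩
    -- A homomorphism that is nonzero on the `i`-th idempotent is the `i`-th projection.
    have h1 : e c * Pi.single i 1 = (e c i) • (Pi.single i 1 : PrimeSpectrum C → K) := by
      ext j
      by_cases hj : j = i
      · subst hj; simp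
      · simp [hj]
    have h2 := congrArg φ' h1
    rw [map_mul, map_smul, smul_eq_mul] at h2
    simpa [φ'] using (mul_right_cancel₀ hi h2).symm

namespace CurveCover

/-! ### Complex points and the classical topology -/

namespace ComplexPoints

variable {X Y : Over SpecC}

theorem liesIn_iff {x : ComplexPoints X} {U : X.left.Opens} :
    x.LiesIn U ↔ x.1 (IsLocalRing.closedPoint ℂ) ∈ U := by
  refine ⟨fun h => h (Set.mem_univ _), fun h z _ => ?_⟩
  rwa [Subsingleton.elim z (IsLocalRing.closedPoint ℂ : PrimeSpectrum ℂ)]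

theorem exists_affine_liesIn {x : ComplexPoints X} {U : X.left.Opens} (hx : x.LiesIn U) :
    ∃ W : X.left.Opens, IsAffineOpen W ∧ W ≤ U ∧ x.LiesIn W := by
  obtain ⟨_, ⟨W, hW, rfl⟩, hxW, hWU⟩ := X.left.isBasis_affineOpens.exists_subset_of_mem_open
    (liesIn_iff.mp hx) U.2
  exact ⟨W, hW, hWU, liesIn_iff.mpr hxW⟩

/-- Evaluation of regular functions at a complex point, as a ring homomorphism. -/
noncomputable def evalHom (x : ComplexPoints X) {U : X.left.Opens} (hx : x.LiesIn U) :
    Γ(X.left, U) →+* ℂ :=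
  (x.1.appLE U ⊤ hx ≫ (Scheme.ΓSpecIso (CommRingCat.of ℂ)).hom).hom

theorem evalHom_apply (x : ComplexPoints X) {U : X.left.Opens} (hx : x.LiesIn U)
    (f : Γ(X.left, U)) : x.evalHom hx f = x.eval hx f := rfl

theorem SpecMap_evalHom_fromSpec (x : ComplexPoints X) {U : X.left.Opens} (hU : IsAffineOpen U)
    (hx : x.LiesIn U) : Spec.map (CommRingCat.ofHom (x.evalHom hx)) ≫ hU.fromSpec = x.1 := by
  rw [evalHom, CommRingCat.ofHom_hom, Spec.map_comp, Category.assoc,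
    hU.SpecMap_appLE_fromSpec x.1 (isAffineOpen_top _) hx, IsAffineOpen.fromSpec_top,
    Scheme.isoSpec_Spec_inv, ← Category.assoc, ← Spec.map_comp, Iso.inv_hom_id, Spec.map_id,
    Category.id_comp]

theorem evalHom_eq_of_SpecMap_eq (x : ComplexPoints X) {U : X.left.Opens} (hU : IsAffineOpen U)
    (hx : x.LiesIn U) (φ : Γ(X.left, U) →+* ℂ)
    (h : Spec.map (CommRingCat.ofHom φ) ≫ hU.fromSpec = x.1) : x.evalHom hx = φ := by
  rw [← x.SpecMap_evalHom_fromSpec hU hx, cancel_mono] at h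
  exact congrArg CommRingCat.Hom.hom (Spec.map_injective h.symm)

theorem ext_of_evalHom_eq {x y : ComplexPoints X} {U : X.left.Opens} (hU : IsAffineOpen U)
    (hx : x.LiesIn U) (hy : y.LiesIn U) (h : x.evalHom hx = y.evalHom hy) : x = y := by
  apply Subtype.ext
  rw [← x.SpecMap_evalHom_fromSpec hU hx, ← y.SpecMap_evalHom_fromSpec hU hy, h]

theorem evalHom_map (p : X ⟶ Y) (x : ComplexPoints X) {W : Y.left.Opens} (hx : (map p x).LiesIn W)
    {V : X.left.Opens} (hV : x.LiesIn V) (e : V ≤ p.left ⁻¹ᵁ W) :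
    (map p x).evalHom hx = (x.evalHom hV).comp (p.left.appLE W V e).hom := by
  have : (map p x).1.appLE W ⊤ hx = p.left.appLE W V e ≫ x.1.appLE V ⊤ hV :=
    (Scheme.Hom.appLE_comp_appLE _ _ _ _ _ _ _).symm
  rw [evalHom, this, Category.assoc]
  rfl

theorem isOpen_liesIn (U : X.left.Opens) : IsOpen {x : ComplexPoints X | x.LiesIn U} :=
  TopologicalSpace.isOpen_generateFrom_of_mem ⟨U, 0, Set.univ, isOpen_univ, by simp⟩

open Classical in
/-- The extension by zero of a regular function on `U` to all complex points. -/
noncomputable def extendByZero {U : X.left.Opens} (f : Γ(X.left, U)) (x : ComplexPoints X) : ℂ :=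
  if hx : x.LiesIn U then x.evalHom hx f else 0

theorem extendByZero_of_liesIn {U : X.left.Opens} (f : Γ(X.left, U)) {x : ComplexPoints X}
    (hx : x.LiesIn U) : extendByZero f x = x.evalHom hx f := dif_pos hx

/-- The points of `U` form an open set, so the value 0 outside `U` does no harm near `x`. -/
theorem continuousAt_extendByZero {U : X.left.Opens} (f : Γ(X.left, U)) {x : ComplexPoints X}
    (hx : x.LiesIn U) : ContinuousAt (extendByZero f) x := by
  rw [continuousAt_def]
  intro S hS
  obtain ⟨V, hVS, hV, hxV⟩ := mem_nhds_iff.mp hS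
  have hopen : IsOpen {z : ComplexPoints X | ∃ hz : z.LiesIn U, z.eval hz f ∈ V} :=
    TopologicalSpace.isOpen_generateFrom_of_mem ⟨U, f, V, hV, rfl⟩
  refine Filter.mem_of_superset (hopen.mem_nhds ⟨hx, ?_⟩) ?_
  · rwa [extendByZero_of_liesIn f hx] at hxV
  · rintro z ⟨hz, hzV⟩
    rw [Set.mem_preimage, extendByZero_of_liesIn f hz]
    exact hVS hzV

theorem continuous_map (p : X ⟶ Y) : Continuous (map p) := by
  refine continuous_generateFrom_iff.mpr ?_
  rintro _ ⟨U, f, V, hV, rfl⟩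
  refine TopologicalSpace.isOpen_generateFrom_of_mem
    ⟨p.left ⁻¹ᵁ U, p.left.app U f, V, hV, ?_⟩
  ext x
  refine exists_congr fun hx => ?_
  rw [← evalHom_apply, evalHom_map p x hx (V := p.left ⁻¹ᵁ U) hx le_rfl, Scheme.Hom.appLE_eq_app]
  rfl

end ComplexPoints

/-! ### Affine charts over which the covering is étale -/

section Chart

variable {X Y : Scheme.{0}} (p : X ⟶ Y)

theorem isPullback_SpecMap_app [IsAffineHom p] {W : Y.Opens} (hW : IsAffineOpen W) :
    IsPullback (Spec.map (p.app W)) (hW.preimage p).fromSpec hW.fromSpec p := by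
  refine IsOpenImmersion.isPullback _ _ _ _ ?_ ?_
  · rw [← Scheme.Hom.appLE_eq_app, hW.SpecMap_appLE_fromSpec p (hW.preimage p) le_rfl]
  · rw [hW.opensRange_fromSpec, (hW.preimage p).opensRange_fromSpec]

theorem exists_etale_of_mem_unbranchedLocus {y : Y} (hy : y ∈ unbranchedLocus p) :
    ∃ U : Y.Opens, y ∈ U ∧ Etale (p ∣_ U) := by
  obtain ⟨U, hU, hyU⟩ := TopologicalSpace.Opens.mem_sSup.mp hy
  exact ⟨U, hyU, hU⟩

/-- The inclusion of `p⁻¹(W)` followed by `p` factors through the étale map `p⁻¹(U) → Y`; the open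
immersion of `W` into `Y` is then cancelled. -/
theorem etale_app [IsAffineHom p] {W U : Y.Opens} (hW : IsAffineOpen W) (hWU : W ≤ U)
    [Etale (p ∣_ U)] : (p.app W).hom.Etale := by
  have h1 : Etale ((p ⁻¹ᵁ U).ι ≫ p) := by
    rw [← morphismRestrict_ι]; infer_instance
  have hV := hW.preimage p
  have h2 : Etale (hV.fromSpec ≫ p) := by
    have : hV.fromSpec ≫ p =
        (hV.isoSpec.inv ≫ X.homOfLE (p.preimage_mono hWU)) ≫ (p ⁻¹ᵁ U).ι ≫ p := by
      rw [IsAffineOpen.fromSpec, Category.assoc, Category.assoc,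
        Scheme.homOfLE_ι_assoc]
    rw [this]
    infer_instance
  rw [← (isPullback_SpecMap_app p hW).w] at h2
  have := Etale.of_comp (Spec.map (p.app W)) hW.fromSpec
  exact HasRingHomProperty.Spec_iff.mp this

end Chart

variable {X Y : Over SpecC}

open ComplexPoints

theorem exists_chart {p : X ⟶ Y} [IsAffineHom p.left] {y : ComplexPoints Y}
    (hy : y ∈ unbranchedPoints p) :
    ∃ W : Y.left.Opens, IsAffineOpen W ∧ y.LiesIn W ∧ (p.left.app W).hom.Etale := by
  obtain ⟨U, hyU, hU⟩ := exists_etale_of_mem_unbranchedLocus _ (liesIn_iff.mp hy)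
  obtain ⟨W, hW, hWU, hyW⟩ := exists_affine_liesIn (liesIn_iff.mpr hyU)
  exact ⟨W, hW, hyW, etale_app p.left hW hWU⟩

/-! ### Uniqueness of lifts -/

/-- Continuous lifts to `X(ℂ)` of a map to the unbranched points of `Y(ℂ)` that agree at one point
of a preconnected space are equal. -/
theorem eq_of_map_eq {p : X ⟶ Y} [IsAffineHom p.left] {T : Type*} [TopologicalSpace T]
    [PreconnectedSpace T] {γ δ : T → ComplexPoints X} (hγ : Continuous γ) (hδ : Continuous δ)
    (h : ∀ t, map p (γ t) = map p (δ t)) (hu : ∀ t, map p (γ t) ∈ unbranchedPoints p)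
    (t₀ t₁ : T) (h₀ : γ t₀ = δ t₀) : γ t₁ = δ t₁ := by
  suffices IsLocallyConstant (fun t => γ t = δ t) from
    (this.apply_eq_of_preconnectedSpace t₀ t₁).mp h₀
  rw [IsLocallyConstant.iff_eventually_eq]
  intro t
  obtain ⟨W, hW, htW, het⟩ := exists_chart (hu t)
  have hV := hW.preimage p.left
  algebraize [(p.left.app W).hom]
  obtain ⟨s, hs⟩ := Algebra.FormallyUnramified.exists_separating
    (A := Γ(Y.left, W)) (B := Γ(X.left, p.left ⁻¹ᵁ W))
  have hδt : (δ t).LiesIn (p.left ⁻¹ᵁ W) := by rw [h t] at htW; exact htW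
  -- The separating tensor, evaluated at the two lifts, is the indicator of their agreement.
  have key : ∀ t', (hγ' : (γ t').LiesIn (p.left ⁻¹ᵁ W)) → (hδ' : (δ t').LiesIn (p.left ⁻¹ᵁ W)) →
      ∑ i ∈ s, extendByZero i.1 (γ t') * extendByZero i.2 (δ t') =
        open Classical in if γ t' = δ t' then 1 else 0 := by
    intro t' hγ' hδ'
    have hcomp : ((γ t').evalHom hγ').comp (p.left.app W).hom =
        ((δ t').evalHom hδ').comp (p.left.app W).hom := by
      have h1 := evalHom_map p (γ t') (W := W) hγ' hγ' le_rfl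
      have h2 := evalHom_map p (δ t') (W := W) hδ' hδ' le_rfl
      rw [Scheme.Hom.appLE_eq_app] at h1 h2
      rw [← h1, ← h2]
      congr 1
      exact h t'
    simp only [extendByZero_of_liesIn _ hγ', extendByZero_of_liesIn _ hδ']
    obtain ⟨hz, ho⟩ := hs _ _ hcomp
    split_ifs with heq
    · exact ho (by congr 1)
    · obtain ⟨b, hb⟩ : ∃ b, (γ t').evalHom hγ' b ≠ (δ t').evalHom hδ' b := by
        by_contra! hc
        exact heq (ext_of_evalHom_eq hV hγ' hδ' (RingHom.ext hc))
      exact (mul_eq_zero.mp (hz b)).resolve_left (sub_ne_zero.mpr hb)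
  have hcont : ContinuousAt
      (fun t' => ∑ i ∈ s, extendByZero i.1 (γ t') * extendByZero i.2 (δ t')) t :=
    tendsto_finsetSum _ fun i _ =>
      ((continuousAt_extendByZero i.1 htW).comp hγ.continuousAt).mul
        ((continuousAt_extendByZero i.2 hδt).comp hδ.continuousAt)
  have e1 := hγ.continuousAt.eventually ((isOpen_liesIn (p.left ⁻¹ᵁ W)).mem_nhds htW)
  have e2 := hδ.continuousAt.eventually ((isOpen_liesIn (p.left ⁻¹ᵁ W)).mem_nhds hδt)
  -- A continuous function with values in `{0, 1}` cannot jump: radius 1 already separates them.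
  have hnear := Metric.continuousAt_iff'.mp hcont 1 one_pos
  filter_upwards [e1, e2, hnear] with t' h1 h2 h3
  rw [key t' h1 h2, key t htW hδt] at h3
  split_ifs at h3 <;> simp_all

/-! ### Counting the points of a fibre -/

theorem finrank_app {p : X ⟶ Y} {d : ℕ} (hp : IsCoveringOfDegree p.left d) {W : Y.left.Opens}
    (hW : IsAffineOpen W) (q : PrimeSpectrum Γ(Y.left, W)) :
    (p.left.app W).hom.Finite ∧ (p.left.app W).hom.Flat ∧ (p.left.app W).hom.finrank q = d := by
  have := hp.finite
  have := hp.flat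
  have hpb := isPullback_SpecMap_app p.left hW
  have h1 : IsFinite (Spec.map (p.left.app W)) := MorphismProperty.of_isPullback hpb.flip ‹_›
  have h2 : Flat (Spec.map (p.left.app W)) := MorphismProperty.of_isPullback hpb.flip ‹_›
  have h1' := (IsFinite.SpecMap_iff _).mp h1
  have h2' := Flat.SpecMap_iff.mp h2
  refine ⟨h1', h2', ?_⟩
  rw [← hp.degree (hW.fromSpec q), ← Scheme.Hom.finrank_of_isPullback _ _ _ _ hpb.flip q,
    Scheme.Hom.finrank_SpecMap_eq_finrank h1' h2']

/-- The fibre of `p` over a complex point `y` of an affine open `W` consists of the homomorphisms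
to `ℂ` of the coordinate ring of `p⁻¹(W)` that extend evaluation at `y`. -/
noncomputable def fibreEquiv (p : X ⟶ Y) [IsAffineHom p.left] {W : Y.left.Opens}
    (hW : IsAffineOpen W) (y : ComplexPoints Y) (hy : y.LiesIn W) :
    {x : ComplexPoints X // map p x = y} ≃
      {φ : Γ(X.left, p.left ⁻¹ᵁ W) →+* ℂ // φ.comp (p.left.app W).hom = y.evalHom hy} where
  toFun x := ⟨x.1.evalHom (U := p.left ⁻¹ᵁ W) (by
      have := x.2 ▸ hy
      exact this), by
    obtain ⟨x, rfl⟩ := x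
    rw [evalHom_map p x (W := W) hy (V := p.left ⁻¹ᵁ W) hy le_rfl, Scheme.Hom.appLE_eq_app]⟩
  invFun φ := by
    have h : (Spec.map (CommRingCat.ofHom φ.1) ≫ (hW.preimage p.left).fromSpec) ≫ p.left = y.1 := by
      have hφ : p.left.app W ≫ CommRingCat.ofHom φ.1 = CommRingCat.ofHom (y.evalHom hy) :=
        CommRingCat.hom_ext φ.2
      rw [Category.assoc, ← (isPullback_SpecMap_app p.left hW).w, ← Category.assoc,
        ← Spec.map_comp, hφ, y.SpecMap_evalHom_fromSpec hW hy]
    exact ⟨⟨Spec.map (CommRingCat.ofHom φ.1) ≫ (hW.preimage p.left).fromSpec, by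
      rw [← Over.w p, ← Category.assoc, h, y.2]⟩, Subtype.ext h⟩
  left_inv x := Subtype.ext (Subtype.ext
    (x.1.SpecMap_evalHom_fromSpec (hW.preimage p.left) _))
  right_inv φ := Subtype.ext (evalHom_eq_of_SpecMap_eq _ (hW.preimage p.left) _ _ rfl)

/-- A covering of degree `d` has `d` complex points over every unbranched point. -/
theorem card_fibre {p : X ⟶ Y} {d : ℕ} (hp : IsCoveringOfDegree p.left d) {y : ComplexPoints Y}
    (hy : y ∈ unbranchedPoints p) : Nat.card {x : ComplexPoints X // map p x = y} = d := by
  have := hp.finite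
  obtain ⟨W, hW, hyW, het⟩ := exists_chart hy
  rw [Nat.card_congr (fibreEquiv p hW y hyW)]
  let q : PrimeSpectrum ℂ := IsLocalRing.closedPoint ℂ
  obtain ⟨hfin, hflat, hd⟩ := finrank_app hp hW (q.comap (y.evalHom hyW))
  let _ := (y.evalHom hyW).toAlgebra
  algebraize [(p.left.app W).hom]
  let e : {φ : Γ(X.left, p.left ⁻¹ᵁ W) →+* ℂ // φ.comp (p.left.app W).hom = y.evalHom hyW} ≃
      (Γ(X.left, p.left ⁻¹ᵁ W) →ₐ[Γ(Y.left, W)] ℂ) :=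
    { toFun := fun φ => { φ.1 with commutes' := fun r => congr($(φ.2) r) }
      invFun := fun φ => ⟨φ.toRingHom, RingHom.ext φ.commutes⟩
      left_inv := fun φ => rfl
      right_inv := fun φ => rfl }
  -- Points of the fibre are `ℂ`-algebra maps to `ℂ` from the fibre algebra, which is étale over
  -- `ℂ`; its dimension is the rank `d`, as rank survives base change.
  rw [Nat.card_congr (e.trans (AlgHom.liftEquiv Γ(Y.left, W) ℂ Γ(X.left, p.left ⁻¹ᵁ W) ℂ)),
    Algebra.Etale.card_algHom_eq_finrank, ← hd]
  have h1 := congrFun (Module.rankAtStalk_eq_finrank_of_free (R := ℂ)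
    (M := ℂ ⊗[Γ(Y.left, W)] Γ(X.left, p.left ⁻¹ᵁ W))) q
  rw [Module.rankAtStalk_baseChange] at h1
  exact h1.symm

/-! ### Rigidity at an unbranched point -/

/-- An endomorphism over `Y` of a reduced irreducible scheme that is affine over `Y` is the identity
if it fixes a complex point at which the structure map is étale. -/
theorem eq_id_of_map_eq_self {p : X ⟶ Y} [IsAffineHom p.left] [IsReduced X.left]
    [IrreducibleSpace X.left] (F : X ⟶ X) (hF : F ≫ p = p) {x : ComplexPoints X}
    (hu : map p x ∈ unbranchedPoints p) (hx : map F x = x) : F = 𝟙 X := by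
  have hF' : F.left ≫ p.left = p.left := congrArg (·.left) hF
  obtain ⟨W, hW, hxW, het⟩ := exists_chart hu
  have hV := hW.preimage p.left
  have hxV : x.LiesIn (p.left ⁻¹ᵁ W) := hxW
  have : IsIntegral X.left := isIntegral_of_irreducibleSpace_of_isReduced _
  have : Nonempty (p.left ⁻¹ᵁ W) := ⟨_, liesIn_iff.mp hxV⟩
  have hle : p.left ⁻¹ᵁ W ≤ F.left ⁻¹ᵁ (p.left ⁻¹ᵁ W) := by
    rw [← Scheme.Hom.comp_preimage, hF']
  algebraize [(p.left.app W).hom]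
  obtain ⟨s, hs⟩ := Algebra.FormallyUnramified.exists_separating
    (A := Γ(Y.left, W)) (B := Γ(X.left, p.left ⁻¹ᵁ W))
  let φ := (F.left.appLE _ _ hle).hom
  have hφ : φ.comp (p.left.app W).hom = (p.left.app W).hom := by
    have : p.left.app W ≫ F.left.appLE _ _ hle = p.left.app W := by
      rw [Scheme.Hom.app_eq_appLE, Scheme.Hom.appLE_comp_appLE]
      simp only [hF']
    exact congrArg CommRingCat.Hom.hom this
  obtain ⟨hz, -⟩ := hs φ (RingHom.id _) (by rw [RingHom.id_comp]; exact hφ)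
  have hev : (x.evalHom hxV).comp φ = x.evalHom hxV := by
    have hFx : (map F x).LiesIn (p.left ⁻¹ᵁ W) := by rw [hx]; exact hxV
    rw [← evalHom_map F x hFx hxV hle]
    congr 1
  obtain ⟨-, ho⟩ := hs (x.evalHom hxV) (x.evalHom hxV) rfl
  -- At `x`, `φ` and the identity become the same evaluation, so the sum has value 1 there. In a
  -- domain a nonzero factor can be cancelled from `hz`, giving `φ = id`.
  have hne : ∑ i ∈ s, φ i.1 * RingHom.id _ i.2 ≠ 0 := by
    intro h0
    have := congrArg (x.evalHom hxV) h0
    simp only [map_sum, map_mul, RingHom.id_apply, map_zero] at this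
    simp only [← RingHom.comp_apply, hev, ho rfl] at this
    exact one_ne_zero this
  have hid : F.left.appLE _ _ hle = 𝟙 _ := by
    refine CommRingCat.hom_ext (RingHom.ext fun b => ?_)
    exact sub_eq_zero.mp ((mul_eq_zero.mp (hz b)).resolve_right hne)
  have hfs : hV.fromSpec ≫ F.left = hV.fromSpec ≫ 𝟙 _ := by
    rw [← hV.SpecMap_appLE_fromSpec F.left hV hle, hid, Spec.map_id, Category.id_comp,
      Category.comp_id]
  have hdom : IsDominant hV.fromSpec := by
    refine ⟨?_⟩
    rw [DenseRange, hV.range_fromSpec]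
    exact (p.left ⁻¹ᵁ W).2.dense ⟨_, liesIn_iff.mp hxV⟩
  apply Over.OverMorphism.ext
  -- The chart is dense in the reduced `X` and `p` is separated, so agreement there suffices.
  exact ext_of_isDominant_of_isSeparated p.left (hF'.trans (Category.id_comp _).symm) hV.fromSpec hfs

end CurveCover

/-! ### The main theorem -/

theorem lemma4p2 (X Y : Over CurveCover.SpecC)
    (hX : CurveCover.IsSmoothProjectiveCurve X) (hY : CurveCover.IsSmoothProjectiveCurve Y)
    (p : X ⟶ Y) (d : ℕ) (hp : CurveCover.IsCoveringOfDegree p.left d) (hd : d ≠ 2)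
    (y₀ : CurveCover.unbranchedPoints p)
    (hmon : CurveCover.monodromyGroup (CurveCover.unbranchedCover p) y₀ = ⊤) :
    ∀ f : Aut (Over.mk p.left), f = 1 := by
  open CurveCover ComplexPoints in
  intro f
  have := hp.finite
  have := hp.flat
  have := hp.surjective
  have := hX.irreducible
  have := hX.smooth
  have := SmoothOfRelativeDimension.smooth 1 X.hom
  have := Smooth.isReduced_of_field X.hom
  have hf : f.hom.left ≫ p.left = p.left := Over.w f.hom
  let F : X ⟶ X := Over.homMk f.hom.left (by
    rw [← Over.w p, ← Category.assoc]; exact congrArg (· ≫ Y.hom) hf)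
  have hF : F ≫ p = p := Over.OverMorphism.ext hf
  have hmap : ∀ x, map p (map F x) = map p x := fun x => by
    apply Subtype.ext
    exact (Category.assoc _ _ _).trans (congrArg (x.1 ≫ ·) hf)
  let E := unbranchedCover p ⁻¹' {y₀}
  let e : E ≃ {x : ComplexPoints X // map p x = y₀.1} :=
    { toFun := fun x => ⟨x.1.1, congrArg Subtype.val x.2⟩
      invFun := fun x => ⟨⟨x.1, by rw [Set.mem_preimage, x.2]; exact y₀.2⟩, Subtype.ext x.2⟩
      left_inv := fun _ => rfl
      right_inv := fun _ => rfl }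
  have hcard : Nat.card E = d := (Nat.card_congr e).trans (card_fibre hp y₀.2)
  let φ : E → E := fun x => e.symm ⟨map F x.1.1, (hmap _).trans (e x).2⟩
  have hcomm : ∀ (σ : Equiv.Perm E) (a : E), φ (σ a) = σ (φ a) := by
    intro σ a
    obtain ⟨γ, hγ⟩ : σ ∈ monodromyGroup (unbranchedCover p) y₀ := hmon ▸ Subgroup.mem_top σ
    obtain ⟨γ₁, h₁⟩ := hγ a
    obtain ⟨γ₂, h₂⟩ := hγ (φ a)
    have h₁' : ∀ t, map p (γ₁ t).1 = (γ t).1 := fun t => congrArg Subtype.val (h₁ t)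
    have h₂' : ∀ t, map p (γ₂ t).1 = (γ t).1 := fun t => congrArg Subtype.val (h₂ t)
    -- The image under `F` of the lift from `a` and the lift from `φ a` lie over the same loop and
    -- start together; their endpoints give the commutation.
    have := eq_of_map_eq (p := p) (γ := fun t => map F (γ₁ t).1) (δ := fun t => (γ₂ t).1)
      ((continuous_map F).comp (continuous_subtype_val.comp γ₁.continuous))
      (continuous_subtype_val.comp γ₂.continuous)
      (fun t => by rw [hmap, h₁', h₂']) (fun t => by rw [hmap, h₁']; exact (γ t).2) 0 1
      (by simp only [γ₁.source, γ₂.source]; rfl)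
    simp only [γ₁.target, γ₂.target] at this
    exact Subtype.ext (Subtype.ext this)
  -- Surjectivity of `p` makes the degree positive, so there is a point to fix.
  have hpos : Nat.card E ≠ 0 := by
    rw [hcard, ← hp.degree (y₀.1.1 (IsLocalRing.closedPoint ℂ))]
    exact Nat.one_le_iff_ne_zero.mp
      ((Scheme.Hom.one_le_finrank_iff_surjective p.left).mpr inferInstance _)
  obtain ⟨x⟩ := (Nat.card_ne_zero.mp hpos).1
  have hfix : φ x = x := Equiv.Perm.eq_self_of_forall_comm (by rwa [hcard]) φ hcomm x
  have hF1 : F = 𝟙 X := eq_id_of_map_eq_self F hF (x := x.1.1) x.1.2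
    (congrArg (fun z : E => z.1.1) hfix)
  apply Iso.ext
  apply Over.OverMorphism.ext
  exact congrArg (·.left) hF1
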